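/- For a probability measure $\pi$ on $\mathbb R$ let $p_\pi(x)=\int \varphi(x-\theta)\,\pi(d\theta)$ denote the density of $\pi * N(0,1)$, where $\varphi$ is the standard normal density. Given data $x_1,\dots,x_n\in\mathbb R$ with $n\ge 1$, an NPMLE is any probability measure $\hat\pi$ on $\mathbb R$ that maximizes $\frac1n\sum_{i=1}^n\log p_\pi(x_i)$ over all probability measures $\pi$ on $\mathbb R$. Write $x_{\min}=\min_i x_i$ and $x_{\max}=\max_i x_i$. (a) There is a universal constant $C_0>0$ such that, for every $n\ge1$ and all $x_1,\dots,x_n\in\mathbb R$, an NPMLE exists and every NPMLE $\hat\pi$ has finite support with $$|\operatorname{supp}(\hat\pi)|\le \max\{1,\;C_0\,(x_{\max}-x_{\min})^2\}.$$ (b) For every $s\ge 0$ and $\tau>0$ there is a constant $C=C(s,\tau)>0$ such that the following holds for every $n\ge1$. Let $x_1,\dots,x_n$ be i.i.d. from $\pi * N(0,1)$, where the probability measure $\pi$ is $s$-subgaussian, i.e. $\int e^{t\theta}\,\pi(d\theta)\le e^{st^2/2}$ for all $t\in\mathbb R$. Then with probability at least $1-n^{-\tau}$, every NPMLE $\hat\pi$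 has finite support with $$|\operatorname{supp}(\hat\pi)|\le C\log n.$$ -/

import Mathlib

open MeasureTheory ProbabilityTheory
open scoped NNReal

/-- The density at `x` of the Gaussian location mixture `π * N(0,1)`:
`p_π(x) = ∫ p_θ(x) π(dθ)`, where `p_θ` is the density of `N(θ,1)`. -/
noncomputable def mixtureDensity (π : Measure ℝ) (x : ℝ) : ℝ :=
  ∫ θ, gaussianPDFReal θ 1 x ∂π

/-- The normalized mixture log-likelihood `(1/n) ∑ᵢ log p_π(xᵢ)` of the data `x₁, …, xₙ`. -/
noncomputable def logLikelihood {n : ℕ} (x : Fin n → ℝ) (π : Measure ℝ) : ℝ :=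
  (1 / (n : ℝ)) * ∑ i, Real.log (mixtureDensity π (x i))

/-- `π` is a nonparametric maximum likelihood estimator of the mixing distribution: a probability
measure on `ℝ` that maximizes the mixture likelihood among all probability measures on `ℝ`. -/
def IsNPMLE {n : ℕ} (x : Fin n → ℝ) (π : Measure ℝ) : Prop :=
  IsProbabilityMeasure π ∧
    ∀ ρ : Measure ℝ, IsProbabilityMeasure ρ → logLikelihood x ρ ≤ logLikelihood x π

/-!
Write `p = p_μ` for the mixture density of an NPMLE `μ` of the data `x₁, …, xₙ`. Moving from `μ`
towards a point mass `δ_θ` cannot increase the likelihood, so the gradient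
`D(θ) = (1/n) ∑ᵢ φ(xᵢ - θ) / p(xᵢ)` satisfies `D ≤ 1` everywhere; since `∫ D dμ = 1` and `D` is
continuous, `D = 1` on the support of `μ` (`IsNPMLE.gaussianSum_le_one`,
`IsNPMLE.gaussianSum_eq_one_of_mem_support`). The support bound is therefore a bound on the number
of solutions of `D = 1`, where `D` is a positive combination of Gaussian bumps centred at the data
and bounded by `1`.

Let the data lie in `[a, b]`. Beyond the data `D` decays: `D(b + t) ≤ e^{-t²/2} D(b)`
(`gaussianSum_add_le`), and symmetrically on the left, so all solutions lie in `[a, b]`. If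
`b - a < 1`, each bump is strictly midpoint concave on `[a, b]`, so there is at most one solution.
If `b - a ≥ 1`, the entire function `D - 1` is counted by a Jensen-type inequality
(`norm_center_le_mul_half_pow_card`) on discs centred at `b + 2`: at the centre it has modulus at
least `1 / 2` by the decay, while `|D(u + iv)| ≤ e^{v²/2} D(u) ≤ e^{v²/2}` bounds it by
`exp (O((b - a)²))` on the large circle. This leaves `O((b - a)²)` zeros.

Existence follows by compactness: projecting a mixing measure onto `[a, b]` moves every atom closer
to every data point and so increases the likelihood, and the probability measures on the compact
interval `[a, b]` are weakly compact.

For i.i.d. data, `π * N(0, 1)` is `(s + 1)`-subgaussian, so by a union bound all `|xᵢ|` are at most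
a multiple of `√(log n)` with probability at least `1 - n^{-τ}`, and the deterministic bound applies.
-/

/-! ### Counting zeros of an entire function -/

/-- A form of Jensen's inequality: each zero of `f` in the disc of radius `r` halves the bound on
the modulus at the centre that the maximum principle gives on the disc of radius `3 * r`. A zero `a`
is divided out by passing to `dslope f a`, which on the circle of radius `3 * r` costs a factor
`|z - a| ≥ 2 * r`, against a gain of `|c - a| ≤ r` at the centre. -/
theorem norm_center_le_mul_half_pow_card {f : ℂ → ℂ} (hf : Differentiable ℂ f) {c : ℂ} {r M : ℝ}
    (hr : 0 < r) (hM : ∀ z ∈ Metric.sphere c (3 * r), ‖f z‖ ≤ M) (S : Finset ℂ)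
    (hS : ∀ z ∈ S, z ∈ Metric.closedBall c r ∧ f z = 0) :
    ‖f c‖ ≤ M * (1 / 2) ^ S.card := by
  induction S using Finset.induction_on generalizing f M with
  | empty =>
    have h := Complex.norm_le_of_forall_mem_frontier_norm_le (Metric.isBounded_ball (x := c)
      (r := 3 * r)) hf.diffContOnCl (C := M) (by
        rw [frontier_ball c (by positivity)]; exact hM)
      (subset_closure (Metric.mem_ball_self (by positivity)))
    simpa using h
  | insert a S ha ih =>
    obtain ⟨haball, hfa⟩ := hS a (Finset.mem_insert_self a S)
    have hg : Differentiable ℂ (dslope f a) := by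
      rw [← differentiableOn_univ] at hf ⊢
      exact (Complex.differentiableOn_dslope Filter.univ_mem).2 hf
    have hfg : ∀ z, f z = (z - a) * dslope f a z := fun z => by
      have := sub_smul_dslope f a z
      rw [hfa, sub_zero, smul_eq_mul] at this
      exact this.symm
    have hac : ‖c - a‖ ≤ r := by
      rw [← dist_eq_norm, dist_comm]; exact haball
    have key := ih hg (M := M / (2 * r)) (fun z hz => by
      rw [le_div_iff₀ (by positivity)]
      have h1 : 2 * r ≤ ‖z - a‖ := by
        have hz' : ‖z - c‖ = 3 * r := by rw [← dist_eq_norm]; exact hz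
        have h2 : ‖z - c‖ ≤ ‖z - a‖ + ‖c - a‖ := by
          have := norm_sub_le (z - a) (c - a)
          rwa [sub_sub_sub_cancel_right] at this
        linarith
      calc ‖dslope f a z‖ * (2 * r) ≤ ‖dslope f a z‖ * ‖z - a‖ := by gcongr
        _ = ‖f z‖ := by rw [hfg z, norm_mul, mul_comm]
        _ ≤ M := hM z hz) (fun z hz => by
      obtain ⟨h1, h2⟩ := hS z (Finset.mem_insert_of_mem hz)
      refine ⟨h1, ?_⟩
      rw [hfg z] at h2
      have hza : z ≠ a := fun h => ha (h ▸ hz)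
      exact (mul_eq_zero.1 h2).resolve_left (sub_ne_zero.2 hza))
    rw [Finset.card_insert_of_notMem ha, hfg c, norm_mul]
    calc ‖c - a‖ * ‖dslope f a c‖ ≤ r * (M / (2 * r) * (1 / 2) ^ S.card) := by gcongr
      _ = M * (1 / 2) ^ (S.card + 1) := by field_simp; ring

/-! ### Level sets of sums of Gaussian bumps -/

/-- The positive combination `θ ↦ ∑ᵢ wᵢ exp (-(xᵢ - θ)² / 2)` of Gaussian bumps centred at the
points `xᵢ`. The normalizing constant of the Gaussian density is left to the weights. -/
noncomputable def gaussianSum {ι : Type*} [Fintype ι] (w x : ι → ℝ) (θ : ℝ) : ℝ :=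
  ∑ i, w i * Real.exp (-(x i - θ) ^ 2 / 2)

section GaussianSum

variable {ι : Type*} [Fintype ι] {w x : ι → ℝ} {a b : ℝ}

theorem continuous_gaussianSum : Continuous (gaussianSum w x) := by
  unfold gaussianSum; fun_prop

theorem gaussianSum_neg (θ : ℝ) : gaussianSum w (-x) (-θ) = gaussianSum w x θ := by
  unfold gaussianSum
  refine Finset.sum_congr rfl fun i _ => ?_
  simp only [Pi.neg_apply]
  ring_nf

/-- Gaussian decay to the right of all the centres. -/
theorem gaussianSum_add_le (hw : ∀ i, 0 ≤ w i) (hx : ∀ i, x i ≤ b) {t : ℝ} (ht : 0 ≤ t) :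
    gaussianSum w x (b + t) ≤ Real.exp (-t ^ 2 / 2) * gaussianSum w x b := by
  unfold gaussianSum
  rw [Finset.mul_sum]
  refine Finset.sum_le_sum fun i _ => ?_
  rw [mul_left_comm, ← Real.exp_add]
  refine mul_le_mul_of_nonneg_left (Real.exp_le_exp.2 ?_) (hw i)
  nlinarith [mul_nonneg ht (sub_nonneg.2 (hx i))]

theorem le_of_gaussianSum_eq_one (hw : ∀ i, 0 ≤ w i) (hle : ∀ θ, gaussianSum w x θ ≤ 1)
    (hx : ∀ i, x i ≤ b) {θ : ℝ} (hθ : gaussianSum w x θ = 1) : θ ≤ b := by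
  by_contra! h
  have h1 := gaussianSum_add_le hw hx (t := θ - b) (by linarith)
  rw [add_sub_cancel, hθ] at h1
  have h2 : Real.exp (-(θ - b) ^ 2 / 2) < 1 := by
    rw [Real.exp_lt_one_iff]
    have : 0 < θ - b := by linarith
    have : 0 < (θ - b) ^ 2 := by positivity
    linarith
  nlinarith [hle b, Real.exp_pos (-(θ - b) ^ 2 / 2)]

theorem mem_Icc_of_gaussianSum_eq_one (hw : ∀ i, 0 ≤ w i) (hle : ∀ θ, gaussianSum w x θ ≤ 1)
    (hx : ∀ i, x i ∈ Set.Icc a b) {θ : ℝ} (hθ : gaussianSum w x θ = 1) : θ ∈ Set.Icc a b := by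
  refine ⟨?_, le_of_gaussianSum_eq_one hw hle (fun i => (hx i).2) hθ⟩
  have := le_of_gaussianSum_eq_one (w := w) (x := -x) (b := -a) (θ := -θ) hw
    (fun t => by rw [← neg_neg t, gaussianSum_neg]; exact hle _)
    (fun i => neg_le_neg (hx i).1) (by rwa [gaussianSum_neg])
  linarith

/-- Strict midpoint concavity of `u ↦ exp (-u ^ 2 / 2)` for pairs whose midpoint `m` satisfies
`|m| < 1`; it amounts to `cosh (m * d) < exp (d ^ 2 / 2)`. -/
theorem exp_neg_sq_add_lt {m d : ℝ} (hm : |m| < 1) (hd : d ≠ 0) :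
    Real.exp (-(m - d) ^ 2 / 2) + Real.exp (-(m + d) ^ 2 / 2) < 2 * Real.exp (-m ^ 2 / 2) := by
  have hcosh : Real.cosh (m * d) < Real.exp (d ^ 2 / 2) := by
    refine (Real.cosh_le_exp_half_sq _).trans_lt (Real.exp_lt_exp.2 ?_)
    have h1 : m ^ 2 < 1 := (sq_lt_one_iff_abs_lt_one m).2 hm
    have h2 : 0 < d ^ 2 := by positivity
    rw [mul_pow]
    nlinarith
  have h1 : Real.exp (-(m - d) ^ 2 / 2)
      = Real.exp (-m ^ 2 / 2) * Real.exp (-d ^ 2 / 2) * Real.exp (m * d) := by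
    rw [← Real.exp_add, ← Real.exp_add]; ring_nf
  have h2 : Real.exp (-(m + d) ^ 2 / 2)
      = Real.exp (-m ^ 2 / 2) * Real.exp (-d ^ 2 / 2) * Real.exp (-(m * d)) := by
    rw [← Real.exp_add, ← Real.exp_add]; ring_nf
  have h3 : Real.exp (-d ^ 2 / 2) * Real.exp (d ^ 2 / 2) = 1 := by
    rw [← Real.exp_add]; ring_nf; simp
  calc _ = 2 * Real.exp (-m ^ 2 / 2) * (Real.exp (-d ^ 2 / 2) * Real.cosh (m * d)) := by
        rw [h1, h2, Real.cosh_eq]; ring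
    _ < 2 * Real.exp (-m ^ 2 / 2) * (Real.exp (-d ^ 2 / 2) * Real.exp (d ^ 2 / 2)) := by gcongr
    _ = _ := by rw [h3, mul_one]

theorem eq_of_gaussianSum_eq_one [Nonempty ι] (hw : ∀ i, 0 < w i)
    (hle : ∀ θ, gaussianSum w x θ ≤ 1)
    (hx : ∀ i, x i ∈ Set.Icc a b) (hab : b - a < 1) {θ η : ℝ} (hθ : gaussianSum w x θ = 1)
    (hη : gaussianSum w x η = 1) : θ = η := by
  by_contra hne
  have hθI := mem_Icc_of_gaussianSum_eq_one (fun i => (hw i).le) hle hx hθ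
  have hηI := mem_Icc_of_gaussianSum_eq_one (fun i => (hw i).le) hle hx hη
  have key : gaussianSum w x θ + gaussianSum w x η < 2 * gaussianSum w x ((θ + η) / 2) := by
    unfold gaussianSum
    rw [← Finset.sum_add_distrib, Finset.mul_sum]
    refine Finset.sum_lt_sum_of_nonempty Finset.univ_nonempty fun i _ => ?_
    have h := exp_neg_sq_add_lt (m := x i - (θ + η) / 2) (d := (θ - η) / 2)
      (by rw [abs_lt]; constructor <;> linarith [(hx i).1, (hx i).2, hθI.1, hθI.2, hηI.1, hηI.2])
      (div_ne_zero (sub_ne_zero.2 hne) two_ne_zero)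
    have e1 : x i - (θ + η) / 2 - (θ - η) / 2 = x i - θ := by ring
    have e2 : x i - (θ + η) / 2 + (θ - η) / 2 = x i - η := by ring
    rw [e1, e2] at h
    rw [← mul_add, mul_left_comm]
    exact mul_lt_mul_of_pos_left h (hw i)
  linarith [hle ((θ + η) / 2)]

/-- Growth of the entire extension of `gaussianSum w x` in the imaginary direction. -/
theorem norm_cexp_sum_le (hw : ∀ i, 0 ≤ w i) (z : ℂ) :
    ‖∑ i, (w i : ℂ) * Complex.exp (-((x i : ℂ) - z) ^ 2 / 2)‖
      ≤ Real.exp (z.im ^ 2 / 2) * gaussianSum w x z.re := by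
  refine (norm_sum_le _ _).trans_eq ?_
  rw [gaussianSum, Finset.mul_sum]
  refine Finset.sum_congr rfl fun i _ => ?_
  rw [norm_mul, Complex.norm_exp, Complex.norm_real, Real.norm_of_nonneg (hw i),
    mul_left_comm, ← Real.exp_add]
  congr 2
  simp [pow_two]
  ring

theorem card_le_of_gaussianSum_eq_one_of_one_le (hw : ∀ i, 0 ≤ w i)
    (hle : ∀ θ, gaussianSum w x θ ≤ 1) (hx : ∀ i, x i ∈ Set.Icc a b) (hab : 1 ≤ b - a)
    (S : Finset ℝ) (hS : ∀ θ ∈ S, gaussianSum w x θ = 1) :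
    (S.card : ℝ) ≤ 83 * (b - a) ^ 2 := by
  set g : ℂ → ℂ := fun z => ∑ i, (w i : ℂ) * Complex.exp (-((x i : ℂ) - z) ^ 2 / 2) - 1 with hg
  have hg_real : ∀ θ : ℝ, g θ = ((gaussianSum w x θ - 1 : ℝ) : ℂ) := fun θ => by
    simp only [hg, gaussianSum]; push_cast; rfl
  have hgd : Differentiable ℂ g := by
    simp only [hg]; fun_prop
  set r : ℝ := b - a + 2 with hr
  have hr0 : 0 < r := by linarith
  have hcount := norm_center_le_mul_half_pow_card hgd (c := ((b + 2 : ℝ) : ℂ)) (r := r)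
    (M := Real.exp ((3 * r) ^ 2 / 2) + 1) hr0 (fun z hz => by
      refine (norm_sub_le _ _).trans ?_
      rw [norm_one]
      gcongr
      refine (norm_cexp_sum_le hw z).trans ?_
      have him : |z.im| ≤ 3 * r := by
        have h1 : ‖z - ((b + 2 : ℝ) : ℂ)‖ = 3 * r := by rw [← dist_eq_norm]; exact hz
        have h2 := Complex.abs_im_le_norm (z - ((b + 2 : ℝ) : ℂ))
        rw [Complex.sub_im, Complex.ofReal_im, sub_zero, h1] at h2
        exact h2
      calc Real.exp (z.im ^ 2 / 2) * gaussianSum w x z.re ≤ Real.exp (z.im ^ 2 / 2) * 1 := by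
            gcongr; exact hle _
        _ ≤ Real.exp ((3 * r) ^ 2 / 2) := by
            rw [mul_one, ← sq_abs z.im]; gcongr)
    (S.image (fun θ : ℝ => (θ : ℂ))) (fun z hz => by
      obtain ⟨θ, hθ, rfl⟩ := Finset.mem_image.1 hz
      have hI := mem_Icc_of_gaussianSum_eq_one hw hle hx (hS θ hθ)
      refine ⟨?_, by rw [hg_real, hS θ hθ]; simp⟩
      rw [Metric.mem_closedBall, dist_eq_norm, ← Complex.ofReal_sub, Complex.norm_real,
        Real.norm_eq_abs, abs_le]
      constructor <;> linarith [hI.1, hI.2])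
  rw [Finset.card_image_of_injective _ Complex.ofReal_injective, hg_real, Complex.norm_real,
    Real.norm_eq_abs] at hcount
  -- At the centre `b + 2` the decay gives `gaussianSum ≤ exp (-2) ≤ 1 / 2`.
  have hcenter : 1 / 2 ≤ |gaussianSum w x (b + 2) - 1| := by
    have h1 := gaussianSum_add_le hw (fun i => (hx i).2) (t := 2) (by norm_num)
    have h2 : Real.exp (-2 ^ 2 / 2) ≤ 1 / 2 := by
      have h3 : (-2 ^ 2 / 2 : ℝ) ≤ -Real.log 2 := by
        have := Real.log_two_lt_d9; norm_num; linarith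
      refine (Real.exp_le_exp.2 h3).trans_eq ?_
      rw [Real.exp_neg, Real.exp_log two_pos]; norm_num
    have h4 : Real.exp (-2 ^ 2 / 2) * gaussianSum w x b ≤ Real.exp (-2 ^ 2 / 2) * 1 := by
      gcongr; exact hle b
    rw [abs_sub_comm]
    exact le_trans (by linarith) (le_abs_self _)
  have hone : 1 ≤ Real.exp ((3 * r) ^ 2 / 2) := Real.one_le_exp (by positivity)
  have hpow : (2 : ℝ) ^ S.card ≤ 2 ^ 2 * Real.exp ((3 * r) ^ 2 / 2) := by
    have h1 : (1 : ℝ) / 2 ≤ (2 * Real.exp ((3 * r) ^ 2 / 2)) * (1 / 2) ^ S.card := by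
      refine (hcenter.trans hcount).trans ?_
      gcongr; linarith
    rw [one_div_pow, mul_one_div, le_div_iff₀ (by positivity)] at h1
    linarith
  have hlog := Real.log_le_log (by positivity) hpow
  rw [Real.log_mul (by norm_num) (Real.exp_ne_zero _), Real.log_exp, Real.log_pow,
    Real.log_pow] at hlog
  -- Since `1 ≤ b - a`, the radius `r = b - a + 2` is at most `3 * (b - a)`.
  have hr3 : (3 * r) ^ 2 ≤ 81 * (b - a) ^ 2 := by nlinarith
  have hl := Real.log_two_gt_d9
  have hcard : ((S.card : ℝ) - 2) * Real.log 2 ≤ 81 * (b - a) ^ 2 / 2 := by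
    push_cast at hlog; linarith
  rcases le_total (S.card : ℝ) 2 with h | h
  · nlinarith
  · nlinarith

theorem card_le_of_gaussianSum_eq_one [Nonempty ι] (hw : ∀ i, 0 < w i)
    (hle : ∀ θ, gaussianSum w x θ ≤ 1) (hx : ∀ i, x i ∈ Set.Icc a b)
    (S : Finset ℝ) (hS : ∀ θ ∈ S, gaussianSum w x θ = 1) :
    (S.card : ℝ) ≤ max 1 (83 * (b - a) ^ 2) := by
  rcases lt_or_ge (b - a) 1 with hab | hab
  · refine le_max_of_le_left ?_
    exact_mod_cast Finset.card_le_one.2 fun θ hθ η hη =>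
      eq_of_gaussianSum_eq_one hw hle hx hab (hS θ hθ) (hS η hη)
  · exact le_max_of_le_right
      (card_le_of_gaussianSum_eq_one_of_one_le (fun i => (hw i).le) hle hx hab S hS)

theorem finite_and_ncard_le_of_gaussianSum_eq_one [Nonempty ι] (hw : ∀ i, 0 < w i)
    (hle : ∀ θ, gaussianSum w x θ ≤ 1) (hx : ∀ i, x i ∈ Set.Icc a b) {A : Set ℝ}
    (hA : ∀ θ ∈ A, gaussianSum w x θ = 1) :
    A.Finite ∧ (A.ncard : ℝ) ≤ max 1 (83 * (b - a) ^ 2) := by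
  have hbound : ∀ S : Finset ℝ, (S : Set ℝ) ⊆ A → (S.card : ℝ) ≤ max 1 (83 * (b - a) ^ 2) :=
    fun S hS => card_le_of_gaussianSum_eq_one hw hle hx S fun θ hθ => hA θ (hS hθ)
  have hfin : A.Finite := by
    by_contra hinf
    obtain ⟨S, hSA, hcard⟩ := Set.Infinite.exists_subset_card_eq hinf
      (⌊max 1 (83 * (b - a) ^ 2)⌋₊ + 1)
    have h := hbound S hSA
    rw [hcard] at h
    push_cast at h
    exact (Nat.lt_floor_add_one (max 1 (83 * (b - a) ^ 2))).not_ge h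
  refine ⟨hfin, ?_⟩
  rw [Set.ncard_eq_toFinset_card A hfin]
  exact hbound _ (by simp)

end GaussianSum

/-! ### The gradient of the likelihood at an NPMLE -/

section Likelihood

variable {n : ℕ} {x : Fin n → ℝ} {μ ρ : Measure ℝ}

theorem gaussianPDFReal_one_eq (θ y : ℝ) :
    gaussianPDFReal θ 1 y = (√(2 * Real.pi))⁻¹ * Real.exp (-(y - θ) ^ 2 / 2) := by
  simp [gaussianPDFReal]

theorem continuous_gaussianPDFReal_mean (y : ℝ) : Continuous fun θ => gaussianPDFReal θ 1 y := by
  simp only [gaussianPDFReal_one_eq]; fun_prop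

theorem gaussianPDFReal_one_le (θ y : ℝ) : gaussianPDFReal θ 1 y ≤ (√(2 * Real.pi))⁻¹ := by
  rw [gaussianPDFReal_one_eq]
  refine mul_le_of_le_one_right (by positivity) (Real.exp_le_one_iff.2 ?_)
  linarith [sq_nonneg (y - θ)]

theorem norm_gaussianPDFReal_one_le (θ y : ℝ) :
    ‖gaussianPDFReal θ 1 y‖ ≤ (√(2 * Real.pi))⁻¹ := by
  rw [Real.norm_of_nonneg (gaussianPDFReal_nonneg _ _ _)]
  exact gaussianPDFReal_one_le θ y

theorem integrable_gaussianPDFReal_mean [IsFiniteMeasure μ] (y : ℝ) :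
    Integrable (fun θ => gaussianPDFReal θ 1 y) μ :=
  .of_bound (continuous_gaussianPDFReal_mean y).aestronglyMeasurable _
    (.of_forall fun θ => norm_gaussianPDFReal_one_le θ y)

theorem mixtureDensity_pos [IsProbabilityMeasure μ] (y : ℝ) : 0 < mixtureDensity μ y := by
  rw [mixtureDensity, integral_pos_iff_support_of_nonneg
    (fun θ => gaussianPDFReal_nonneg _ _ _) (integrable_gaussianPDFReal_mean y)]
  have : (Function.support fun θ => gaussianPDFReal θ 1 y) = Set.univ :=
    Set.eq_univ_of_forall fun θ => (gaussianPDFReal_pos θ 1 y one_ne_zero).ne'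
  simp [this]

theorem mixtureDensity_add_dirac [IsProbabilityMeasure μ] {ε : ℝ} (h0 : 0 ≤ ε) (h1 : ε ≤ 1)
    (θ y : ℝ) :
    mixtureDensity (ENNReal.ofReal (1 - ε) • μ + ENNReal.ofReal ε • Measure.dirac θ) y
      = (1 - ε) * mixtureDensity μ y + ε * gaussianPDFReal θ 1 y := by
  unfold mixtureDensity
  rw [integral_add_measure, integral_smul_measure, integral_smul_measure, integral_dirac,
    ENNReal.toReal_ofReal (by linarith), ENNReal.toReal_ofReal h0, smul_eq_mul, smul_eq_mul]
  · exact (integrable_gaussianPDFReal_mean y).smul_measure ENNReal.ofReal_ne_top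
  · exact (integrable_gaussianPDFReal_mean y).smul_measure ENNReal.ofReal_ne_top

theorem isProbabilityMeasure_add_dirac [IsProbabilityMeasure μ] {ε : ℝ} (h0 : 0 ≤ ε)
    (h1 : ε ≤ 1) (θ : ℝ) :
    IsProbabilityMeasure (ENNReal.ofReal (1 - ε) • μ + ENNReal.ofReal ε • Measure.dirac θ) := by
  constructor
  simp only [Measure.coe_add, Measure.coe_smul, Pi.add_apply, Pi.smul_apply, measure_univ,
    smul_eq_mul, mul_one]
  rw [← ENNReal.ofReal_add (by linarith) h0]
  simp

theorem logLikelihood_le_iff (hn : 1 ≤ n) :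
    logLikelihood x ρ ≤ logLikelihood x μ ↔
      ∑ i, Real.log (mixtureDensity ρ (x i)) ≤ ∑ i, Real.log (mixtureDensity μ (x i)) := by
  have : (0 : ℝ) < 1 / n := by positivity
  exact mul_le_mul_iff_of_pos_left this

/-- First-order optimality of `μ` in the direction of a point mass at `θ`: with
`q i = φ(xᵢ - θ) / p_μ(xᵢ)`, the mean of the ratios `q i` is at most `1`. -/
theorem IsNPMLE.sum_ratio_le (hn : 1 ≤ n) (h : IsNPMLE x μ) (θ : ℝ) :
    ∑ i, gaussianPDFReal θ 1 (x i) / mixtureDensity μ (x i) ≤ n := by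
  have := h.1
  set q : Fin n → ℝ := fun i => gaussianPDFReal θ 1 (x i) / mixtureDensity μ (x i) with hq
  have hq0 : ∀ i, 0 < q i := fun i =>
    div_pos (gaussianPDFReal_pos _ _ _ one_ne_zero) (mixtureDensity_pos _)
  -- Comparing `μ` with `(1 - ε) μ + ε δ_θ` gives `∑ log (1 + ε (q i - 1)) ≤ 0`. The inequality
  -- `1 - 1 / u ≤ log u` bounds the left side below without differentiating the logarithm.
  have hstep : ∀ ε : ℝ, 0 < ε → ε < 1 → ∑ i, (q i - 1) / (1 + ε * (q i - 1)) ≤ 0 := by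
    intro ε h0 h1
    have hpos : ∀ i, 0 < 1 + ε * (q i - 1) := fun i => by nlinarith [mul_pos h0 (hq0 i)]
    have hmax := (logLikelihood_le_iff hn).1
      (h.2 _ (isProbabilityMeasure_add_dirac (μ := μ) h0.le h1.le θ))
    have hlog : ∀ i, ε * ((q i - 1) / (1 + ε * (q i - 1))) ≤
        Real.log (mixtureDensity
          (ENNReal.ofReal (1 - ε) • μ + ENNReal.ofReal ε • Measure.dirac θ) (x i))
          - Real.log (mixtureDensity μ (x i)) := fun i => by
      have hp := mixtureDensity_pos (μ := μ) (x i)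
      have e : mixtureDensity
          (ENNReal.ofReal (1 - ε) • μ + ENNReal.ofReal ε • Measure.dirac θ) (x i)
          = mixtureDensity μ (x i) * (1 + ε * (q i - 1)) := by
        rw [mixtureDensity_add_dirac h0.le h1.le]
        simp only [hq]
        field_simp
        ring
      rw [e, Real.log_mul hp.ne' (hpos i).ne', add_sub_cancel_left]
      refine le_trans (le_of_eq ?_) (Real.one_sub_inv_le_log_of_pos (hpos i))
      have := (hpos i).ne'
      field_simp
      ring
    have hsum := Finset.sum_le_sum fun i (_ : i ∈ Finset.univ) => hlog i
    rw [Finset.sum_sub_distrib, ← Finset.mul_sum] at hsum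
    by_contra! hcon
    linarith [mul_pos h0 hcon]
  have hlim : Filter.Tendsto (fun ε : ℝ => ∑ i, (q i - 1) / (1 + ε * (q i - 1)))
      (nhdsWithin 0 (Set.Ioi 0)) (nhds (∑ i, (q i - 1))) := by
    refine tendsto_finsetSum _ fun i _ => ?_
    have hc : ContinuousAt (fun ε : ℝ => (q i - 1) / (1 + ε * (q i - 1))) 0 :=
      ContinuousAt.div (by fun_prop) (by fun_prop) (by simp)
    have := hc.tendsto.mono_left (nhdsWithin_le_nhds (s := Set.Ioi 0))
    simpa using this
  have hle : ∑ i, (q i - 1) ≤ 0 := by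
    refine le_of_tendsto hlim ?_
    filter_upwards [Ioo_mem_nhdsGT (show (0 : ℝ) < 1 by norm_num)] with ε hε
    exact hstep ε hε.1 hε.2
  simp only [Finset.sum_sub_distrib, Finset.sum_const, Finset.card_univ, Fintype.card_fin,
    nsmul_eq_mul, mul_one] at hle
  linarith

/-- The weights for which `gaussianSum` is the gradient function
`θ ↦ (1/n) ∑ᵢ φ(xᵢ - θ) / p_μ(xᵢ)` of the log-likelihood at `μ`; they contain the normalizing
constant `1 / √(2π)` of the Gaussian density. -/
noncomputable def gradientWeight (x : Fin n → ℝ) (μ : Measure ℝ) (i : Fin n) : ℝ :=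
  (√(2 * Real.pi))⁻¹ / (n * mixtureDensity μ (x i))

theorem gaussianSum_gradientWeight (θ : ℝ) :
    gaussianSum (gradientWeight x μ) x θ
      = (∑ i, gaussianPDFReal θ 1 (x i) / mixtureDensity μ (x i)) / n := by
  unfold gaussianSum gradientWeight
  rw [Finset.sum_div]
  refine Finset.sum_congr rfl fun i _ => ?_
  rw [gaussianPDFReal_one_eq, div_div, mul_comm (n : ℝ), div_mul_eq_mul_div]

theorem gradientWeight_pos (hn : 1 ≤ n) [IsProbabilityMeasure μ] (i : Fin n) :
    0 < gradientWeight x μ i := by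
  have := mixtureDensity_pos (μ := μ) (x i)
  unfold gradientWeight
  positivity

theorem IsNPMLE.gaussianSum_le_one (hn : 1 ≤ n) (h : IsNPMLE x μ) (θ : ℝ) :
    gaussianSum (gradientWeight x μ) x θ ≤ 1 := by
  rw [gaussianSum_gradientWeight]
  exact div_le_one_of_le₀ (h.sum_ratio_le hn θ) (by positivity)

theorem integrable_gaussianSum_gradientWeight [IsProbabilityMeasure μ] :
    Integrable (gaussianSum (gradientWeight x μ) x) μ := by
  rw [funext gaussianSum_gradientWeight]
  exact (integrable_finsetSum _ fun i _ =>
    (integrable_gaussianPDFReal_mean (x i)).div_const _).div_const _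

theorem integral_gaussianSum_gradientWeight (hn : 1 ≤ n) [IsProbabilityMeasure μ] :
    ∫ θ, gaussianSum (gradientWeight x μ) x θ ∂μ = 1 := by
  simp only [gaussianSum_gradientWeight]
  rw [integral_div, integral_finsetSum _ fun i _ =>
    (integrable_gaussianPDFReal_mean (x i)).div_const _]
  have h1 : ∀ i, ∫ θ, gaussianPDFReal θ 1 (x i) / mixtureDensity μ (x i) ∂μ = 1 := fun i => by
    rw [integral_div]
    exact div_self (mixtureDensity_pos (x i)).ne'
  simp only [h1, Finset.sum_const, Finset.card_univ, Fintype.card_fin, nsmul_eq_mul, mul_one]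
  exact div_self (by positivity)

/-- Complementary slackness: the gradient function attains its maximal value `1` at every point of
the support, because it is continuous, at most `1`, and has mean `1` under `μ`. -/
theorem IsNPMLE.gaussianSum_eq_one_of_mem_support (hn : 1 ≤ n) (h : IsNPMLE x μ) {θ : ℝ}
    (hθ : θ ∈ μ.support) : gaussianSum (gradientWeight x μ) x θ = 1 := by
  have := h.1
  have hint := integrable_gaussianSum_gradientWeight (x := x) (μ := μ)
  have hzero : ∫ θ, (1 - gaussianSum (gradientWeight x μ) x θ) ∂μ = 0 := by
    rw [integral_sub (integrable_const _) hint, integral_gaussianSum_gradientWeight hn]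
    simp
  rw [integral_eq_zero_iff_of_nonneg (fun t => sub_nonneg.2 (h.gaussianSum_le_one hn t))
    ((integrable_const _).sub hint)] at hzero
  have hclosed : IsClosed {t | gaussianSum (gradientWeight x μ) x t = 1} :=
    isClosed_eq continuous_gaussianSum continuous_const
  refine Measure.support_subset_of_isClosed hclosed ?_ hθ
  filter_upwards [hzero] with t ht
  exact (sub_eq_zero.1 ht).symm

theorem IsNPMLE.support_finite_and_ncard_le (hn : 1 ≤ n) (h : IsNPMLE x μ) {a b : ℝ}
    (hx : ∀ i, x i ∈ Set.Icc a b) :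
    μ.support.Finite ∧ (μ.support.ncard : ℝ) ≤ max 1 (83 * (b - a) ^ 2) := by
  have := h.1
  have : Nonempty (Fin n) := ⟨⟨0, hn⟩⟩
  exact finite_and_ncard_le_of_gaussianSum_eq_one (gradientWeight_pos hn)
    (h.gaussianSum_le_one hn) hx fun θ hθ => h.gaussianSum_eq_one_of_mem_support hn hθ

/-! ### Existence of an NPMLE -/

theorem gaussianPDFReal_le_projIcc {a b y : ℝ} (hab : a ≤ b) (hy : y ∈ Set.Icc a b) (θ : ℝ) :
    gaussianPDFReal θ 1 y ≤ gaussianPDFReal (Set.projIcc a b hab θ) 1 y := by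
  rw [gaussianPDFReal_one_eq, gaussianPDFReal_one_eq]
  refine mul_le_mul_of_nonneg_left (Real.exp_le_exp.2 ?_) (by positivity)
  have hdist : (y - Set.projIcc a b hab θ) ^ 2 ≤ (y - θ) ^ 2 := by
    rcases le_total θ a with h | h
    · rw [Set.projIcc_of_le_left hab h]; nlinarith [hy.1]
    rcases le_total b θ with h' | h'
    · rw [Set.projIcc_of_right_le hab h']; nlinarith [hy.2]
    · rw [Set.projIcc_of_mem hab ⟨h, h'⟩]
  linarith

theorem mixtureDensity_map_val {a b : ℝ} (ν : Measure (Set.Icc a b)) (y : ℝ) :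
    mixtureDensity (ν.map Subtype.val) y = ∫ θ, gaussianPDFReal (θ : ℝ) 1 y ∂ν :=
  integral_map measurable_subtype_coe.aemeasurable
    (continuous_gaussianPDFReal_mean y).aestronglyMeasurable

theorem mixtureDensity_le_map_projIcc [IsProbabilityMeasure ρ] {a b y : ℝ} (hab : a ≤ b)
    (hy : y ∈ Set.Icc a b) :
    mixtureDensity ρ y ≤ mixtureDensity ((ρ.map (Set.projIcc a b hab)).map Subtype.val) y := by
  have hm : Measurable (Set.projIcc a b hab) := continuous_projIcc.measurable
  rw [mixtureDensity_map_val, integral_map (f := fun θ : Set.Icc a b => gaussianPDFReal (θ : ℝ) 1 y)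
    hm.aemeasurable
    ((continuous_gaussianPDFReal_mean y).comp continuous_subtype_val).aestronglyMeasurable]
  refine integral_mono (integrable_gaussianPDFReal_mean y) ?_
    fun θ => gaussianPDFReal_le_projIcc hab hy θ
  exact .of_bound ((continuous_gaussianPDFReal_mean y).comp
    (continuous_subtype_val.comp continuous_projIcc)).aestronglyMeasurable _
    (.of_forall fun θ => norm_gaussianPDFReal_one_le _ y)

theorem exists_isNPMLE (hn : 1 ≤ n) {a b : ℝ} (hx : ∀ i, x i ∈ Set.Icc a b) :
    ∃ μ, IsNPMLE x μ := by
  have hab : a ≤ b := (hx ⟨0, hn⟩).1.trans (hx ⟨0, hn⟩).2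
  have hprob : ∀ ν : ProbabilityMeasure (Set.Icc a b),
      IsProbabilityMeasure ((ν : Measure (Set.Icc a b)).map Subtype.val) := fun ν =>
    Measure.isProbabilityMeasure_map measurable_subtype_coe.aemeasurable
  have hcont : Continuous fun ν : ProbabilityMeasure (Set.Icc a b) =>
      ∑ i, Real.log (mixtureDensity ((ν : Measure (Set.Icc a b)).map Subtype.val) (x i)) := by
    refine continuous_finsetSum _ fun i _ => Continuous.log ?_ fun ν =>
      have := hprob ν; (mixtureDensity_pos _).ne'
    simp only [mixtureDensity_map_val]
    exact ProbabilityMeasure.continuous_integral_boundedContinuousFunction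
      (BoundedContinuousFunction.mkOfCompact ⟨fun θ : Set.Icc a b => gaussianPDFReal (θ : ℝ) 1 (x i),
        (continuous_gaussianPDFReal_mean (x i)).comp continuous_subtype_val⟩)
  obtain ⟨ν, -, hν⟩ := isCompact_univ.exists_isMaxOn
    ⟨⟨Measure.dirac ⟨a, Set.left_mem_Icc.2 hab⟩, inferInstance⟩, Set.mem_univ _⟩ hcont.continuousOn
  refine ⟨_, hprob ν, fun ρ hρ => (logLikelihood_le_iff hn).2 ?_⟩
  let σ : ProbabilityMeasure (Set.Icc a b) := ⟨ρ.map (Set.projIcc a b hab),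
    Measure.isProbabilityMeasure_map continuous_projIcc.measurable.aemeasurable⟩
  refine le_trans (Finset.sum_le_sum fun i _ => ?_) (hν (Set.mem_univ σ))
  exact Real.log_le_log (mixtureDensity_pos _) (mixtureDensity_le_map_projIcc hab (hx i))

end Likelihood

/-! ### The range of subgaussian samples -/

section Tail

theorem ProbabilityTheory.HasSubgaussianMGF.conv {μ ν : Measure ℝ} [IsProbabilityMeasure μ]
    [IsProbabilityMeasure ν] {c d : ℝ≥0} (hμ : HasSubgaussianMGF id c μ)
    (hν : HasSubgaussianMGF id d ν) : HasSubgaussianMGF id (c + d) (μ.conv ν) := by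
  have h1 : HasSubgaussianMGF (fun p : ℝ × ℝ => p.1) c (μ.prod ν) := by
    rw [← HasSubgaussianMGF.id_map_iff measurable_fst.aemeasurable, Measure.map_fst_prod]
    simpa using hμ
  have h2 : HasSubgaussianMGF (fun p : ℝ × ℝ => p.2) d (μ.prod ν) := by
    rw [← HasSubgaussianMGF.id_map_iff measurable_snd.aemeasurable, Measure.map_snd_prod]
    simpa using hν
  rw [Measure.conv, HasSubgaussianMGF.id_map_iff (by fun_prop)]
  exact h1.add_of_indepFun h2 (indepFun_prod measurable_id measurable_id)

theorem hasSubgaussianMGF_id_gaussianReal (v : ℝ≥0) :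
    HasSubgaussianMGF id v (gaussianReal 0 v) where
  integrable_exp_mul t := integrable_exp_mul_gaussianReal t
  mgf_le t := by simp [mgf_id_gaussianReal]

theorem measureReal_lt_abs_le {P : Measure ℝ} [IsProbabilityMeasure P] {c : ℝ≥0}
    (h : HasSubgaussianMGF id c P) {t : ℝ} (ht : 0 ≤ t) :
    P.real {y | t < |y|} ≤ 2 * Real.exp (-t ^ 2 / (2 * c)) := by
  have hsub : {y : ℝ | t < |y|} ⊆ {y | t ≤ id y} ∪ {y | t ≤ (-id) y} := fun y hy => by
    rcases lt_abs.1 (show t < |y| from hy) with h | h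
    · exact Or.inl h.le
    · exact Or.inr h.le
  calc P.real {y | t < |y|} ≤ P.real ({y | t ≤ id y} ∪ {y | t ≤ (-id) y}) := measureReal_mono hsub
    _ ≤ P.real {y | t ≤ id y} + P.real {y | t ≤ (-id) y} := measureReal_union_le _ _
    _ ≤ 2 * Real.exp (-t ^ 2 / (2 * c)) := by
      linarith [h.measure_ge_le ht, h.neg.measure_ge_le ht]

theorem measurableSet_forall_abs_le (n : ℕ) (t : ℝ) :
    MeasurableSet {x : Fin n → ℝ | ∀ i, |x i| ≤ t} := by
  rw [Set.ofPred_forall]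
  exact MeasurableSet.iInter fun i => measurableSet_le (by fun_prop) measurable_const

theorem one_sub_le_measureReal_forall_abs_le {P : Measure ℝ} [IsProbabilityMeasure P] {c : ℝ≥0}
    (h : HasSubgaussianMGF id c P) (n : ℕ) {t : ℝ} (ht : 0 ≤ t) :
    1 - n * (2 * Real.exp (-t ^ 2 / (2 * c))) ≤
      (Measure.pi fun _ : Fin n => P).real {x | ∀ i, |x i| ≤ t} := by
  have hcompl : {x : Fin n → ℝ | ∀ i, |x i| ≤ t}ᶜ = ⋃ i, Function.eval i ⁻¹' {y | t < |y|} := by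
    ext x; simp
  have hle : (Measure.pi fun _ : Fin n => P).real {x | ∀ i, |x i| ≤ t}ᶜ
      ≤ n * (2 * Real.exp (-t ^ 2 / (2 * c))) := by
    rw [hcompl]
    refine (measureReal_iUnion_fintype_le _).trans ?_
    have hi : ∀ i : Fin n, (Measure.pi fun _ : Fin n => P).real
        (Function.eval i ⁻¹' {y | t < |y|}) ≤ 2 * Real.exp (-t ^ 2 / (2 * c)) := fun i => by
      rw [(measurePreserving_eval (fun _ : Fin n => P) i).measureReal_preimage
        (measurableSet_lt measurable_const (by fun_prop)).nullMeasurableSet]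
      exact measureReal_lt_abs_le h ht
    simpa using Finset.sum_le_sum fun i (_ : i ∈ Finset.univ) => hi i
  rw [probReal_compl_eq_one_sub (measurableSet_forall_abs_le n t)] at hle
  linarith

end Tail

/-! ### The support of the NPMLE -/

theorem theorem1 :
    (∃ C₀ : ℝ, 0 < C₀ ∧ ∀ (n : ℕ), 1 ≤ n → ∀ x : Fin n → ℝ,
      (∃ πhat : Measure ℝ, IsNPMLE x πhat) ∧
      ∀ πhat : Measure ℝ, IsNPMLE x πhat →
        πhat.support.Finite ∧
          (πhat.support.ncard : ℝ) ≤ max 1 (C₀ * ((⨆ i, x i) - ⨅ i, x i) ^ 2)) ∧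
    (∀ (s : ℝ≥0) (τ : ℝ), 0 < τ → ∃ C : ℝ, 0 < C ∧
      ∀ (n : ℕ), 1 ≤ n → ∀ (π : Measure ℝ) [IsProbabilityMeasure π],
        HasSubgaussianMGF (fun θ : ℝ => θ) s π →
        ∃ E : Set (Fin n → ℝ), MeasurableSet E ∧
          1 - (n : ℝ) ^ (-τ) ≤
            (Measure.pi fun _ : Fin n => Measure.conv π (gaussianReal 0 1)).real E ∧
          ∀ x ∈ E, ∀ πhat : Measure ℝ, IsNPMLE x πhat →
            πhat.support.Finite ∧ (πhat.support.ncard : ℝ) ≤ C * Real.log n) := by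
  refine ⟨⟨83, by norm_num, fun n hn x => ?_⟩, fun s τ hτ => ?_⟩
  · have hx : ∀ i, x i ∈ Set.Icc (⨅ i, x i) (⨆ i, x i) := fun i =>
      ⟨ciInf_le (Set.finite_range x).bddBelow i, le_ciSup (Set.finite_range x).bddAbove i⟩
    exact ⟨exists_isNPMLE hn hx, fun μ hμ => hμ.support_finite_and_ncard_le hn hx⟩
  -- With `t² = K log n`, the union bound over both tails of `n` samples is
  -- `2 n · n^{-(τ + 2)} ≤ n^{-τ}` for `n ≥ 2`.
  · set K : ℝ := 2 * (s + 1) * (τ + 2) with hK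
    have hK0 : 0 < K := by positivity
    refine ⟨2 + 83 * (4 * K), by positivity, fun n hn π _ hπ => ?_⟩
    -- For `n = 1` both bounds vanish: `1 - 1 ^ (-τ) = 0` and `log 1 = 0`, so only the empty
    -- event is available.
    rcases hn.eq_or_lt with rfl | hn2
    · exact ⟨∅, MeasurableSet.empty, by simp, by simp⟩
    have hn2' : (2 : ℝ) ≤ n := by exact_mod_cast hn2
    have hlog2 : Real.log 2 ≤ Real.log n := Real.log_le_log two_pos hn2'
    have hlog : 1 ≤ 2 * Real.log n := by linarith [Real.log_two_gt_d9]
    set t : ℝ := √(K * Real.log n) with ht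
    have ht2 : t ^ 2 = K * Real.log n := Real.sq_sqrt (by nlinarith)
    have hsub : HasSubgaussianMGF id (s + 1) (Measure.conv π (gaussianReal 0 1)) :=
      HasSubgaussianMGF.conv hπ (hasSubgaussianMGF_id_gaussianReal 1)
    refine ⟨{x | ∀ i, |x i| ≤ t}, measurableSet_forall_abs_le n t, ?_, fun x hx μ hμ => ?_⟩
    · refine le_trans ?_ (one_sub_le_measureReal_forall_abs_le hsub n (Real.sqrt_nonneg _))
      have hexp : Real.exp (-t ^ 2 / (2 * ((s + 1 : ℝ≥0) : ℝ)))
          = (n : ℝ) ^ (-τ) * ((n : ℝ) ^ 2)⁻¹ := by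
        have hn0 : (0 : ℝ) < n := by linarith
        have hsq : ((n : ℝ) ^ 2)⁻¹ = (n : ℝ) ^ (-2 : ℝ) := by
          rw [Real.rpow_neg hn0.le, Real.rpow_two]
        rw [hsq, ← Real.rpow_add hn0, Real.rpow_def_of_pos hn0, ht2, hK]
        congr 1
        push_cast
        have : (s : ℝ) + 1 ≠ 0 := by positivity
        field_simp
        ring
      rw [hexp]
      have hτ0 : 0 < (n : ℝ) ^ (-τ) := by positivity
      have : (n : ℝ) * (2 * ((n : ℝ) ^ (-τ) * ((n : ℝ) ^ 2)⁻¹)) = (2 / n) * (n : ℝ) ^ (-τ) := by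
        field_simp
      rw [this]
      have h2n : 2 / (n : ℝ) ≤ 1 := div_le_one_of_le₀ hn2' (by linarith)
      nlinarith
    · obtain ⟨hfin, hcard⟩ := hμ.support_finite_and_ncard_le hn (a := -t) (b := t)
        fun i => abs_le.1 (hx i)
      refine ⟨hfin, hcard.trans (max_le ?_ ?_)⟩
      · nlinarith [mul_pos hK0 (by linarith : 0 < Real.log n)]
      · have : (t - -t) ^ 2 = 4 * (K * Real.log n) := by rw [← ht2]; ring
        rw [this]
        linarith
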